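/- **Setting.** Fix $n,\ell\ge 0$. Graphs $G=(V_G,E_G,\mathsf{col}_G)$ are undirected and simple, with $V_G=[n]$ and vertex labels $\mathsf{col}_G:V_G\to\mathbb R^\ell$. The atomic type $\mathsf{atp}_k(G,\boldsymbol v)\in\mathbb R^{2\binom k2+k\ell}$ of $\boldsymbol v\in V_G^k$ lists the $0/1$ values of $v_i=v_j$ and of $v_iv_j\in E_G$ for $i<j$, and the labels $\mathsf{col}_G(v_i)$. The (folklore) $k$-dimensional Weisfeiler–Leman algorithm $k$-WL computes $\mathsf{wl}_k^{(0)}(G,\boldsymbol v)=\mathsf{atp}_k(G,\boldsymbol v)$ and $$\mathsf{wl}_k^{(t+1)}(G,\boldsymbol v)=\Bigl(\mathsf{wl}_k^{(t)}(G,\boldsymbol v),\{\!\{(\mathsf{atp}_{k+1}(G,\boldsymbol vu),\mathsf{wl}_k^{(t)}(G,\boldsymbol v[u/1]),\dots,\mathsf{wl}_k^{(t)}(G,\boldsymbol v[u/k])) : u\in V_G\}\!\}\Bigr),$$ where $\boldsymbol v[u/i]$ is $\boldsymbol v$ with $v_i$ replaced by $u$. Put $\mathsf{vwl}_k^{(t)}(G,v)=\mathsf{wl}_k^{(t)}(G,(v,\dots,v))$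 and $\mathsf{gwl}_k^{(t)}(G)=\{\!\{\mathsf{wl}_k^{(t)}(G,\boldsymbol v):\boldsymbol v\in V_G^k\}\!\}$. An $m$-IGN with $t$ equivariant layers computes tensors $F^{(0)},\dots,F^{(t)}$ with $F^{(0)}_{\boldsymbol v,:}=\mathsf{atp}_m(G,\boldsymbol v)$ and, for $s=1,\dots,t$, $\boldsymbol v\in[n]^m$ and $j\in[d_s]$, $$F^{(s)}_{\boldsymbol v,j}=\sigma_s\Bigl(\sum_{\gamma}\sum_{\boldsymbol w\in[n]^m}\mathbf 1_{(\boldsymbol v,\boldsymbol w)\in\gamma}\sum_{i\in[d_{s-1}]}c^{(s)}_{\gamma,i,j}F^{(s-1)}_{\boldsymbol w,i}+\sum_{\mu}\mathbf 1_{\boldsymbol v\in\mu}\,b^{(s)}_{\mu,j}\Bigr),$$ where $\gamma$ and $\mu$ range over the equality patterns of $[n]^{2m}$ and $[n]^m$ (the classes of the relation $\boldsymbol a\sim\boldsymbol b$ iff $a_i=a_j\Leftrightarrow b_i=b_j$ for all $i,j$), the coefficients are arbitrary reals and the activation functions $\sigma_s:\mathbb R\to\mathbb R$ are arbitrary. Its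 vertex embedding is $(G,v)\mapsto F^{(t)}_{(v,\dots,v),:}$. A graph embedding is obtained by adding one invariant layer, with values $\sigma\bigl(\sum_\mu\sum_{\boldsymbol w\in[n]^m}\mathbf 1_{\boldsymbol w\in\mu}\sum_i c_{\mu,i,j}F^{(t)}_{\boldsymbol w,i}+b_j\bigr)$. The separation power of a class of functions $\mathcal F$ is the equivalence relation $\rho(\mathcal F)$ that relates two inputs when every $f\in\mathcal F$ takes the same value on both: $\rho_1$ on pairs $(G,v)$, $\rho_0$ on graphs $G$. The separation power of $\mathcal F$ is bounded by that of $g$ if $\rho(g)\subseteq\rho(\mathcal F)$. **Theorem.** Let $k\ge 1$ and $t\ge 0$. 1. The separation power of the vertex embeddings computed by the $(k+1)$-IGNs with $t$ equivariant layers is bounded by that of $t(k+1)$ rounds of $k$-WL, $\rho_1(\mathsf{vwl}_k^{(t(k+1))})\subseteq\rho_1((k+1)\text{-IGN}^{(t)})$; and, if $k\ge 2$, it is even bounded by that of $tk$ rounds, $\rho_1(\mathsf{vwl}_k^{(tk)})\subseteq\rho_1((k+1)\text{-IGN}^{(t)})$. 2. The separation power of the graph embeddings computed by the $(k+1)$-IGNs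 with $t+1$ layers, namely $t$ equivariant layers followed by an invariant one, is bounded by that of $(t+1)k$ rounds of $k$-WL: any two graphs with the same $\mathsf{gwl}_k^{((t+1)k)}$ have the same embeddings. -/

import Mathlib

noncomputable section

/-- Undirected simple graphs on the vertex set `Fin n`, with vertex labels in `ℝ^ℓ`. -/
structure LGraph (n ℓ : ℕ) where
  graph : SimpleGraph (Fin n)
  col : Fin n → Fin ℓ → ℝ

/-! ### Separation power -/

/-- The equivalence relation `ρ(𝓕)` of a family `𝓕` of functions on `X` (each with its own
codomain): two points are related when no function of the family separates them. -/
def rho {X : Type*} {ι : Type*} {β : ι → Type*} (f : ∀ i, X → β i) : Setoid X where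
  r x y := ∀ i, f i x = f i y
  iseqv := ⟨fun _ _ => rfl, fun h i => (h i).symm, fun h h' i => (h i).trans (h' i)⟩

/-- The equivalence relation `ρ(f)` of a single function. -/
def rhoOne {X : Type*} {β : Type*} (f : X → β) : Setoid X :=
  rho (fun _ : Unit => f)

/-! ### Atomic types -/

/-- Pairs `i < j` of positions in a `k`-tuple. -/
abbrev PosPair (k : ℕ) : Type := {p : Fin k × Fin k // p.1 < p.2}

/-- Coordinates of the atomic type of a `k`-tuple: equalities, adjacencies, labels. -/
abbrev AtpIdx (k ℓ : ℕ) : Type := PosPair k ⊕ (PosPair k ⊕ (Fin k × Fin ℓ))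

open Classical in
/-- The atomic type `atp_k(G, v)`, a real vector with `2 * (k choose 2) + k * ℓ` coordinates. -/
def atp {n ℓ : ℕ} (k : ℕ) (G : LGraph n ℓ) (v : Fin k → Fin n) : AtpIdx k ℓ → ℝ
  | Sum.inl p => if v p.1.1 = v p.1.2 then 1 else 0
  | Sum.inr (Sum.inl p) => if G.graph.Adj (v p.1.1) (v p.1.2) then 1 else 0
  | Sum.inr (Sum.inr (i, s)) => G.col (v i) s

/-! ### The (folklore) `k`-dimensional Weisfeiler-Leman algorithm -/

/-- The type of the labels produced by `t` rounds of `k`-WL. -/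
def WLLabel (k ℓ : ℕ) : ℕ → Type
  | 0 => AtpIdx k ℓ → ℝ
  | t + 1 => WLLabel k ℓ t × Multiset ((AtpIdx (k + 1) ℓ → ℝ) × (Fin k → WLLabel k ℓ t))

/-- The label `wl_k^(t)(G, v)` of a `k`-tuple `v` after `t` rounds. -/
def wl {n ℓ : ℕ} (k : ℕ) : (t : ℕ) → LGraph n ℓ → (Fin k → Fin n) → WLLabel k ℓ t
  | 0, G, v => atp k G v
  | t + 1, G, v =>
      (wl k t G v,
        (Finset.univ : Finset (Fin n)).val.map fun u =>
          (atp (k + 1) G (Fin.snoc v u : Fin (k + 1) → Fin n),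
            fun i => wl k t G (Function.update v i u)))

/-- The vertex labelling `vwl_k^(t)(G, v) = wl_k^(t)(G, (v, …, v))`. -/
def vwl (n ℓ k t : ℕ) (p : LGraph n ℓ × Fin n) : WLLabel k ℓ t :=
  wl k t p.1 (fun _ => p.2)

/-- The graph labelling: the multiset of the labels of all `k`-tuples. -/
def gwl (n ℓ k t : ℕ) (G : LGraph n ℓ) : Multiset (WLLabel k ℓ t) :=
  (Finset.univ : Finset (Fin k → Fin n)).val.map fun v => wl k t G v

/-! ### Invariant graph networks -/

/-- Two `q`-tuples over `Fin n` are equivalent when they have the same equality pattern. -/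
def eqPattern (n q : ℕ) : Setoid (Fin q → Fin n) where
  r a b := ∀ i j, a i = a j ↔ b i = b j
  iseqv := ⟨fun _ _ _ => Iff.rfl, fun h i j => (h i j).symm,
    fun h h' i j => (h i j).trans (h' i j)⟩

/-- The set of equality patterns of `q`-tuples over `Fin n`. -/
abbrev Pattern (n q : ℕ) : Type := Quotient (eqPattern n q)

instance (n q : ℕ) : Fintype (Pattern n q) := Fintype.ofFinite _

/-- The pattern (equivalence class) of a tuple. -/
def patternOf {n q : ℕ} (a : Fin q → Fin n) : Pattern n q := Quotient.mk (eqPattern n q) a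

open Classical in
/-- The indicator function of the membership of the tuple `a` in the class `γ`. -/
def patInd {n q : ℕ} (γ : Pattern n q) (a : Fin q → Fin n) : ℝ :=
  if patternOf a = γ then 1 else 0

/-- The parameters of a linear equivariant layer on tensors of order `m` with feature
dimensions `d` (input) and `d'` (output), followed by an activation function. -/
structure EquivLayer (n m d d' : ℕ) where
  act : ℝ → ℝ
  coeff : Pattern n (m + m) → Fin d → Fin d' → ℝ
  bias : Pattern n m → Fin d' → ℝ

/-- The tensor computed by an equivariant layer. -/
def EquivLayer.apply {n m d d' : ℕ} (L : EquivLayer n m d d')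
    (F : (Fin m → Fin n) → Fin d → ℝ) (v : Fin m → Fin n) (j : Fin d') : ℝ :=
  L.act
    ((∑ γ : Pattern n (m + m), ∑ w : Fin m → Fin n,
        patInd γ (Fin.append v w) * ∑ i : Fin d, L.coeff γ i j * F w i)
      + ∑ μ : Pattern n m, patInd μ v * L.bias μ j)

/-- The parameters of a linear invariant layer, followed by an activation function. -/
structure InvLayer (n m d d' : ℕ) where
  act : ℝ → ℝ
  coeff : Pattern n m → Fin d → Fin d' → ℝ
  bias : Fin d' → ℝ

/-- The vector computed by an invariant layer. -/
def InvLayer.apply {n m d d' : ℕ} (L : InvLayer n m d d')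
    (F : (Fin m → Fin n) → Fin d → ℝ) (j : Fin d') : ℝ :=
  L.act
    ((∑ μ : Pattern n m, ∑ w : Fin m → Fin n,
        patInd μ w * ∑ i : Fin d, L.coeff μ i j * F w i)
      + L.bias j)

/-- The dimension of the initial features, `2 * (m choose 2) + m * ℓ`. -/
abbrev atpDim (m ℓ : ℕ) : ℕ := Fintype.card (AtpIdx m ℓ)

/-- `IGN n ℓ m t d`: the `m`-IGNs with `t` equivariant layers and output feature dimension `d`,
on graphs with `n` vertices and labels in `ℝ^ℓ`. -/
inductive IGN (n ℓ m : ℕ) : ℕ → ℕ → Type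
  | init : IGN n ℓ m 0 (atpDim m ℓ)
  | layer {t d d' : ℕ} (N : IGN n ℓ m t d) (L : EquivLayer n m d d') : IGN n ℓ m (t + 1) d'

/-- The tensor computed by an IGN on a graph. -/
def IGN.eval {n ℓ m : ℕ} : {t d : ℕ} → IGN n ℓ m t d → LGraph n ℓ →
    (Fin m → Fin n) → Fin d → ℝ
  | _, _, .init, G => fun v i => atp m G v ((Fintype.equivFin (AtpIdx m ℓ)).symm i)
  | _, _, .layer N L, G => L.apply (N.eval G)

/-- The vertex embeddings `(G, v) ↦ F_{v,…,v,:}` computed by the `m`-IGNs with `t` layers. -/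
def vertexIGN (n ℓ m t : ℕ) (N : Σ d, IGN n ℓ m t d) (p : LGraph n ℓ × Fin n) :
    Fin N.1 → ℝ :=
  N.2.eval p.1 (fun _ => p.2)

/-- The graph embeddings computed by the `m`-IGNs that consist of `t` equivariant layers and a
final invariant layer. -/
def graphIGN (n ℓ m t : ℕ) (N : Σ d d', IGN n ℓ m t d × InvLayer n m d d') (G : LGraph n ℓ) :
    Fin N.2.1 → ℝ :=
  N.2.2.2.apply (N.2.2.1.eval G)

end

/-! One round of `k`-WL amounts to a bijection between the extensions of two equally labelled
`k`-tuples (`exists_perm_wlEquiv_snoc`). Hence a position of a `(k+1)`-tuple can be summed out at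
the cost of one round: the other entries fit into a `k`-tuple (`partialSum_eq`).

In a layer, the indicator of a pattern of `(v, w)` is expanded so that each `w j` is either equated
with some entry of `v` or left free (`exists_patInd_append_expansion`). A term with at most `k` free
positions costs at most `k` rounds. The term with all `k + 1` positions free does not depend on `v`;
it is a global sum, treated apart through `GlobalEquiv`. So a layer costs `k` rounds
(`EquivLayer.wlInvariant`).

Obtaining a global sum of `(k+1)`-tuples from a vertex label takes `k + 1` rounds, which would give
`t * k + 1` in all for `t ≥ 1`. For `k ≥ 2` the excess is absorbed by the first layer: it is linear
in atomic types, whose coordinates see two positions, so it costs one round, or two for its global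
sums (`IGN.wlInvariant_eval_succ`). For graph embeddings, the multiset of labels matches `k`
positions for free, and a global sum costs one round only (`GlobalEquiv.of_gwl_eq`). -/

theorem Multiset.map_univ_eq_iff {α β : Type*} [Fintype α] {f g : α → β} :
    (Finset.univ : Finset α).val.map f = (Finset.univ : Finset α).val.map g ↔
      ∃ π : Equiv.Perm α, f = g ∘ π := by
  classical
  constructor
  · intro h
    have hfib : ∀ b, Nonempty ({a // f a = b} ≃ {a // g a = b}) := by
      intro b
      refine ⟨Fintype.equivOfCardEq ?_⟩
      have hb := congrArg (Multiset.count b) h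
      rw [Multiset.count_map, Multiset.count_map, ← Finset.filter_val, ← Finset.filter_val,
        Finset.card_val, Finset.card_val] at hb
      simpa [Fintype.card_subtype, eq_comm] using hb
    let e := fun b => (hfib b).some
    let π : Equiv.Perm α := (Equiv.sigmaFiberEquiv f).symm.trans
      ((Equiv.sigmaCongrRight e).trans (Equiv.sigmaFiberEquiv g))
    exact ⟨π, funext fun a => (e (f a) ⟨a, rfl⟩).2.symm⟩
  · rintro ⟨π, rfl⟩
    rw [← Multiset.map_map, Multiset.map_univ_val_equiv]

/-! ### Atomic types and labels of subtuples. -/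

/-- Two tuples in two graphs have the same equalities, adjacencies and labels. -/
def AtpEquiv {n ℓ q : ℕ} (G H : LGraph n ℓ) (w w' : Fin q → Fin n) : Prop :=
  (∀ i j, w i = w j ↔ w' i = w' j) ∧
  (∀ i j, G.graph.Adj (w i) (w j) ↔ H.graph.Adj (w' i) (w' j)) ∧
  ∀ i, G.col (w i) = H.col (w' i)

theorem AtpEquiv.comp {n ℓ p q : ℕ} {G H : LGraph n ℓ} {w w' : Fin q → Fin n}
    (h : AtpEquiv G H w w') (g : Fin p → Fin q) : AtpEquiv G H (w ∘ g) (w' ∘ g) :=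
  ⟨fun i j => h.1 (g i) (g j), fun i j => h.2.1 (g i) (g j), fun i => h.2.2 (g i)⟩

theorem atp_eq_iff {n ℓ q : ℕ} {G H : LGraph n ℓ} {w w' : Fin q → Fin n} :
    atp q G w = atp q H w' ↔ AtpEquiv G H w w' := by
  classical
  have ite_iff : ∀ {P Q : Prop} [Decidable P] [Decidable Q],
      ((if P then (1 : ℝ) else 0) = if Q then 1 else 0) ↔ (P ↔ Q) := by
    intro P Q _ _
    by_cases hP : P <;> by_cases hQ : Q <;> simp [hP, hQ]
  constructor
  · intro h
    have heq : ∀ i j, i < j → (w i = w j ↔ w' i = w' j) := fun i j hij => by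
      have := congrFun h (Sum.inl ⟨(i, j), hij⟩)
      simpa only [atp, ite_iff] using this
    have hadj : ∀ i j, i < j →
        (G.graph.Adj (w i) (w j) ↔ H.graph.Adj (w' i) (w' j)) := fun i j hij => by
      have := congrFun h (Sum.inr (Sum.inl ⟨(i, j), hij⟩))
      simpa only [atp, ite_iff] using this
    refine ⟨fun i j => ?_, fun i j => ?_, fun i => funext fun s => ?_⟩
    · rcases lt_trichotomy i j with hij | rfl | hij
      · exact heq i j hij
      · simp
      · rw [eq_comm, heq j i hij, eq_comm]
    · rcases lt_trichotomy i j with hij | rfl | hij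
      · exact hadj i j hij
      · simp
      · rw [SimpleGraph.adj_comm, hadj j i hij, SimpleGraph.adj_comm]
    · exact congrFun h (Sum.inr (Sum.inr (i, s)))
  · rintro ⟨h1, h2, h3⟩
    funext x
    rcases x with p | p | ⟨i, s⟩
    · simp only [atp, h1]
    · simp only [atp, h2]
    · simp only [atp, h3]

/-- Two `q`-tuples have the same atomic type, and all `k`-tuples formed from their entries
have the same labels after `r` rounds of `k`-WL. -/
def WLEquiv {n ℓ q : ℕ} (k r : ℕ) (G H : LGraph n ℓ) (w w' : Fin q → Fin n) : Prop :=
  AtpEquiv G H w w' ∧ ∀ g : Fin k → Fin q, wl k r G (w ∘ g) = wl k r H (w' ∘ g)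

theorem WLEquiv.comp {n ℓ p q k r : ℕ} {G H : LGraph n ℓ} {w w' : Fin q → Fin n}
    (h : WLEquiv k r G H w w') (g : Fin p → Fin q) : WLEquiv k r G H (w ∘ g) (w' ∘ g) :=
  ⟨h.1.comp g, fun f => h.2 (g ∘ f)⟩

theorem wl_eq_mono {n ℓ k r s : ℕ} {G H : LGraph n ℓ} {v v' : Fin k → Fin n} (hrs : r ≤ s)
    (h : wl k s G v = wl k s H v') : wl k r G v = wl k r H v' := by
  induction s, hrs using Nat.le_induction with
  | base => exact h
  | succ s _ ih => exact ih (congrArg Prod.fst h)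

theorem WLEquiv.mono {n ℓ q k r s : ℕ} {G H : LGraph n ℓ} {w w' : Fin q → Fin n} (hrs : r ≤ s)
    (h : WLEquiv k s G H w w') : WLEquiv k r G H w w' :=
  ⟨h.1, fun g => wl_eq_mono hrs (h.2 g)⟩

theorem AtpEquiv.of_wl_eq {n ℓ k r : ℕ} {G H : LGraph n ℓ} {v v' : Fin k → Fin n}
    (h : wl k r G v = wl k r H v') : AtpEquiv G H v v' :=
  atp_eq_iff.1 (wl_eq_mono (Nat.zero_le r) h)

/-! ### One round as a bijection between extensions. -/

/-- Equality of labels after one more round yields a bijection of the extensions. -/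
theorem exists_perm_of_wl_succ_eq {n ℓ k r : ℕ} {G H : LGraph n ℓ} {v v' : Fin k → Fin n}
    (h : wl k (r + 1) G v = wl k (r + 1) H v') :
    ∃ π : Equiv.Perm (Fin n), ∀ u,
      AtpEquiv G H (Fin.snoc v u : Fin (k + 1) → Fin n) (Fin.snoc v' (π u) : Fin (k + 1) → Fin n) ∧
      ∀ i, wl k r G (Function.update v i u) = wl k r H (Function.update v' i (π u)) := by
  have h2 : (wl k (r + 1) G v).2 = (wl k (r + 1) H v').2 := congrArg Prod.snd h
  simp only [wl] at h2
  obtain ⟨π, hπ⟩ := Multiset.map_univ_eq_iff.1 h2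
  refine ⟨π, fun u => ?_⟩
  have := congrFun hπ u
  exact ⟨atp_eq_iff.1 (congrArg Prod.fst this), fun i => congrFun (congrArg Prod.snd this) i⟩

/-- A `k`-tuple of entries of `v u` is made of entries of `v`, or of some `v[u/j]`. -/
theorem snoc_comp_cases {k : ℕ} (g : Fin k → Fin (k + 1)) :
    (∃ g' : Fin k → Fin k, ∀ {α : Type} (v : Fin k → α) (u : α),
      (Fin.snoc v u : Fin (k + 1) → α) ∘ g = v ∘ g') ∨
    ∃ (j : Fin k) (g' : Fin k → Fin k), ∀ {α : Type} (v : Fin k → α) (u : α),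
      (Fin.snoc v u : Fin (k + 1) → α) ∘ g = Function.update v j u ∘ g' := by
  classical
  by_cases hg : ∃ i, g i = Fin.last k
  · right
    obtain ⟨i₀, hi₀⟩ := hg
    -- Pigeonhole: `g` takes only `k` values, one of them the last position, so it misses an earlier
    -- position `j`, where `u` can be stored.
    obtain ⟨j, hj⟩ : ∃ j : Fin k, ∀ i, g i ≠ j.castSucc := by
      by_contra! hcon
      have hs : Function.Surjective g := by
        intro y
        induction y using Fin.lastCases with
        | last => exact ⟨i₀, hi₀⟩
        | cast y => exact hcon y
      have := Fintype.card_le_of_surjective g hs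
      simp at this
    refine ⟨j, fun i => Fin.lastCases (motive := fun _ => Fin k) j (fun x => x) (g i), ?_⟩
    intro α v u
    funext i
    have hji := hj i
    simp only [Function.comp_apply]
    generalize g i = y at hji ⊢
    induction y using Fin.lastCases with
    | last => simp
    | cast y =>
      have : y ≠ j := fun h => hji (by rw [h])
      simp [Function.update_of_ne this]
  · left
    push Not at hg
    refine ⟨fun i => (g i).castPred (hg i), ?_⟩
    intro α v u
    funext i
    have : g i = ((g i).castPred (hg i)).castSucc := by simp
    simp only [Function.comp_apply]
    conv_lhs => rw [this]
    rw [Fin.snoc_castSucc]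

theorem update_comp_eq_snoc_comp {k : ℕ} (g : Fin k → Fin k) (i : Fin k) :
    ∃ h : Fin k → Fin (k + 1), ∀ {α : Type} (v : Fin k → α) (u : α),
      Function.update (v ∘ g) i u = (Fin.snoc v u : Fin (k + 1) → α) ∘ h := by
  classical
  refine ⟨Function.update (Fin.castSucc ∘ g) i (Fin.last k), ?_⟩
  intro α v u
  funext x
  by_cases hx : x = i
  · subst hx; simp
  · simp [Function.update_of_ne hx]

theorem snoc_comp_eq_snoc_comp {k : ℕ} (g : Fin k → Fin k) :
    ∃ h : Fin (k + 1) → Fin (k + 1), ∀ {α : Type} (v : Fin k → α) (u : α),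
      (Fin.snoc (v ∘ g) u : Fin (k + 1) → α) = (Fin.snoc v u : Fin (k + 1) → α) ∘ h := by
  refine ⟨Fin.snoc (Fin.castSucc ∘ g) (Fin.last k), ?_⟩
  intro α v u
  funext x
  induction x using Fin.lastCases with
  | last => simp
  | cast x => simp

/-- Stability under recombining entries is taken as the hypothesis `hcomp` because the lemma also
serves inside the induction that proves it. -/
theorem wl_snoc_comp_eq {n ℓ k r : ℕ} {G H : LGraph n ℓ} {v v' : Fin k → Fin n} {u u' : Fin n}
    (hcomp : ∀ (x x' : Fin k → Fin n), wl k r G x = wl k r H x' →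
      ∀ g : Fin k → Fin k, wl k r G (x ∘ g) = wl k r H (x' ∘ g))
    (h : wl k r G v = wl k r H v')
    (hu : ∀ i, wl k r G (Function.update v i u) = wl k r H (Function.update v' i u'))
    (g : Fin k → Fin (k + 1)) :
    wl k r G ((Fin.snoc v u : Fin (k + 1) → Fin n) ∘ g) =
      wl k r H ((Fin.snoc v' u' : Fin (k + 1) → Fin n) ∘ g) := by
  rcases snoc_comp_cases g with ⟨g', hg'⟩ | ⟨j, g', hg'⟩
  · rw [hg', hg']; exact hcomp _ _ h g'
  · rw [hg', hg']; exact hcomp _ _ (hu j) g'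

/-- The bijection that matches the extensions of `v` and `v'` also matches those of `v ∘ g` and `v'
∘ g`, since every tuple involved is made of entries of `v u`. -/
theorem wl_comp_eq {n ℓ k : ℕ} {G H : LGraph n ℓ} (r : ℕ) (v v' : Fin k → Fin n)
    (h : wl k r G v = wl k r H v') (g : Fin k → Fin k) :
    wl k r G (v ∘ g) = wl k r H (v' ∘ g) := by
  induction r generalizing v v' g with
  | zero => exact atp_eq_iff.2 ((atp_eq_iff.1 h).comp g)
  | succ r ih =>
    have h0 : wl k r G v = wl k r H v' := wl_eq_mono (Nat.le_succ r) h
    obtain ⟨π, hπ⟩ := exists_perm_of_wl_succ_eq h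
    refine Prod.ext (ih v v' h0 g) (Multiset.map_univ_eq_iff.2 ⟨π, funext fun u => ?_⟩)
    refine Prod.ext ?_ (funext fun i => ?_)
    · obtain ⟨f, hf⟩ := snoc_comp_eq_snoc_comp g
      simp only [Function.comp_apply]
      rw [hf, hf]
      exact atp_eq_iff.2 ((hπ u).1.comp f)
    · obtain ⟨f, hf⟩ := update_comp_eq_snoc_comp g i
      simp only [Function.comp_apply]
      rw [hf, hf]
      exact wl_snoc_comp_eq ih h0 (hπ u).2 f

theorem exists_perm_wlEquiv_snoc {n ℓ k r : ℕ} {G H : LGraph n ℓ} {v v' : Fin k → Fin n}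
    (h : wl k (r + 1) G v = wl k (r + 1) H v') :
    ∃ π : Equiv.Perm (Fin n), ∀ u, WLEquiv k r G H
      (Fin.snoc v u : Fin (k + 1) → Fin n) (Fin.snoc v' (π u) : Fin (k + 1) → Fin n) := by
  obtain ⟨π, hπ⟩ := exists_perm_of_wl_succ_eq h
  exact ⟨π, fun u => ⟨(hπ u).1,
    wl_snoc_comp_eq (wl_comp_eq r) (wl_eq_mono (Nat.le_succ r) h) (hπ u).2⟩⟩

/-- One entry of a tuple of at most `k + 1` entries can be quantified at the cost of a round. -/
theorem WLEquiv.exists_perm_update {n ℓ k r q : ℕ} {G H : LGraph n ℓ} {w w' : Fin q → Fin n}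
    (hq : q ≤ k + 1) (h : WLEquiv k (r + 1) G H w w') (j : Fin q) :
    ∃ π : Equiv.Perm (Fin n), ∀ u, WLEquiv k r G H
      (Function.update w j u) (Function.update w' j (π u)) := by
  classical
  obtain ⟨f⟩ : Nonempty ({i : Fin q // i ≠ j} ↪ Fin k) := by
    apply Function.Embedding.nonempty_of_card_le
    simp
    omega
  -- `g` lists all positions but `j`; slots left over when `q < k + 1` are padded with `j`, which is
  -- harmless since `e` never reads them.
  let g : Fin k → Fin q := Function.extend f Subtype.val fun _ => j
  have hg : ∀ i, g (f i) = i := fun i => f.injective.extend_apply _ _ i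
  obtain ⟨π, hπ⟩ := exists_perm_wlEquiv_snoc (h.2 g)
  let e : Fin q → Fin (k + 1) :=
    fun i => if hi : i = j then Fin.last k else (f ⟨i, hi⟩).castSucc
  have he : ∀ (x : Fin q → Fin n) (u : Fin n),
      Function.update x j u = (Fin.snoc (x ∘ g) u : Fin (k + 1) → Fin n) ∘ e := by
    intro x u
    funext i
    by_cases hi : i = j
    · subst hi; simp [e]
    · simp [e, hi, hg]
  refine ⟨π, fun u => ?_⟩
  rw [he, he]
  exact (hπ u).comp e

theorem WLEquiv.const {n ℓ k r q : ℕ} (hk : 1 ≤ k) {G H : LGraph n ℓ} {x x' : Fin n}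
    (h : wl k r G (fun _ => x) = wl k r H (fun _ => x')) :
    WLEquiv k r G H (fun _ : Fin q => x) (fun _ : Fin q => x') := by
  refine ⟨?_, fun g => h⟩
  exact (AtpEquiv.of_wl_eq h).comp fun _ => ⟨0, hk⟩

/-! ### Sums of invariant functions. -/

/-- Two functions of tuples take the same value on equivalent tuples. -/
def WLInvariant {n ℓ q : ℕ} {α : Type*} (k r : ℕ) (G H : LGraph n ℓ)
    (f f' : (Fin q → Fin n) → α) : Prop :=
  ∀ w w', WLEquiv k r G H w w' → f w = f' w'

/-- Invariant functions have the same sum over all `q`-tuples. -/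
def GlobalEquiv {n ℓ : ℕ} (k r q : ℕ) (G H : LGraph n ℓ) : Prop :=
  ∀ f f' : (Fin q → Fin n) → ℝ, WLInvariant k r G H f f' → ∑ w, f w = ∑ w, f' w

theorem GlobalEquiv.mono {n ℓ k r s q : ℕ} {G H : LGraph n ℓ} (hrs : r ≤ s)
    (h : GlobalEquiv k s q G H) : GlobalEquiv k r q G H :=
  fun f f' hf => h f f' fun w w' hw => hf w w' (hw.mono hrs)

open Classical in
/-- The sum of `f` over the tuples that agree with `w` outside `N`. -/
def partialSum {n q : ℕ} (f : (Fin q → Fin n) → ℝ) (N : Finset (Fin q)) (w : Fin q → Fin n) : ℝ :=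
  ∑ z with ∀ j ∉ N, z j = w j, f z

theorem partialSum_empty {n q : ℕ} (f : (Fin q → Fin n) → ℝ) (w : Fin q → Fin n) :
    partialSum f ∅ w = f w := by
  classical
  simp [partialSum, ← funext_iff, Finset.filter_eq']

theorem partialSum_univ {n q : ℕ} (f : (Fin q → Fin n) → ℝ) (w : Fin q → Fin n) :
    partialSum f Finset.univ w = ∑ z, f z := by
  simp [partialSum]

theorem partialSum_insert {n q : ℕ} (f : (Fin q → Fin n) → ℝ) {N : Finset (Fin q)} {j : Fin q}
    (hj : j ∉ N) (w : Fin q → Fin n) :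
    partialSum f (insert j N) w = ∑ u, partialSum f N (Function.update w j u) := by
  classical
  unfold partialSum
  rw [← Finset.sum_fiberwise _ (fun z : Fin q → Fin n => z j)]
  refine Finset.sum_congr rfl fun u _ => Finset.sum_congr ?_ fun _ _ => rfl
  ext z
  simp only [Finset.mem_filter, Finset.mem_univ, true_and, Finset.mem_insert, not_or]
  constructor
  · rintro ⟨h, rfl⟩ i hi
    by_cases hij : i = j
    · subst hij; simp
    · rw [Function.update_of_ne hij, h i ⟨hij, hi⟩]
  · intro h
    refine ⟨fun i hi => ?_, ?_⟩
    · rw [h i hi.2, Function.update_of_ne hi.1]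
    · rw [h j hj, Function.update_self]

theorem partialSum_eq {n ℓ k r q : ℕ} {G H : LGraph n ℓ} (hq : q ≤ k + 1)
    {f f' : (Fin q → Fin n) → ℝ} (hf : WLInvariant k r G H f f') (N : Finset (Fin q))
    {w w' : Fin q → Fin n} (h : WLEquiv k (r + N.card) G H w w') :
    partialSum f N w = partialSum f' N w' := by
  classical
  induction N using Finset.induction_on generalizing w w' with
  | empty => rw [partialSum_empty, partialSum_empty]; exact hf w w' h
  | insert j N hj ih =>
    rw [Finset.card_insert_of_notMem hj] at h
    obtain ⟨π, hπ⟩ := h.exists_perm_update hq j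
    rw [partialSum_insert f hj, partialSum_insert f' hj]
    exact Fintype.sum_equiv π _ _ fun u => ih (hπ u)

theorem GlobalEquiv.of_wlEquiv {n ℓ k r q : ℕ} {G H : LGraph n ℓ} (hq : q ≤ k + 1)
    {w w' : Fin q → Fin n} (h : WLEquiv k (r + q) G H w w') : GlobalEquiv k r q G H := by
  intro f f' hf
  rw [← partialSum_univ f w, ← partialSum_univ f' w']
  exact partialSum_eq hq hf _ (by simpa using h)

/-- The multiset already pairs off the `k`-tuples, so only the last entry of a `(k+1)`-tuple uses up
a round. -/
theorem GlobalEquiv.of_gwl_eq {n ℓ k r : ℕ} {G H : LGraph n ℓ}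
    (h : gwl n ℓ k (r + 1) G = gwl n ℓ k (r + 1) H) : GlobalEquiv k r (k + 1) G H := by
  intro f f' hf
  obtain ⟨π, hπ⟩ := Multiset.map_univ_eq_iff.1 h
  have key : ∀ f : (Fin (k + 1) → Fin n) → ℝ,
      ∑ w, f w = ∑ v : Fin k → Fin n, ∑ u, f (Fin.snoc v u : Fin (k + 1) → Fin n) := by
    intro f
    rw [← (Fin.snocEquiv fun _ => Fin n).sum_comp, Fintype.sum_prod_type, Finset.sum_comm]
    rfl
  rw [key, key]
  refine Fintype.sum_equiv π _ _ fun v => ?_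
  obtain ⟨τ, hτ⟩ := exists_perm_wlEquiv_snoc (congrFun hπ v)
  exact Fintype.sum_equiv τ _ _ fun u => hf _ _ (hτ u)

theorem gwl_eq_mono {n ℓ k r s : ℕ} {G H : LGraph n ℓ} (hrs : r ≤ s)
    (h : gwl n ℓ k s G = gwl n ℓ k s H) : gwl n ℓ k r G = gwl n ℓ k r H := by
  obtain ⟨π, hπ⟩ := Multiset.map_univ_eq_iff.1 h
  exact Multiset.map_univ_eq_iff.2 ⟨π, funext fun v => wl_eq_mono hrs (congrFun hπ v)⟩

/-! ### Equality patterns and their expansion into anchors. -/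

theorem patternOf_eq_iff {n q : ℕ} {a b : Fin q → Fin n} :
    patternOf a = patternOf b ↔ ∀ i j, a i = a j ↔ b i = b j :=
  Quotient.eq

theorem patInd_congr {n q : ℕ} {a b : Fin q → Fin n} (h : patternOf a = patternOf b)
    (γ : Pattern n q) : patInd γ a = patInd γ b := by
  unfold patInd
  rw [h]

theorem patternOf_comp {n p q : ℕ} {a b : Fin q → Fin n} (h : patternOf a = patternOf b)
    (g : Fin p → Fin q) : patternOf (a ∘ g) = patternOf (b ∘ g) :=
  patternOf_eq_iff.2 fun i j => patternOf_eq_iff.1 h (g i) (g j)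

theorem patternOf_append_eq_iff {n p q : ℕ} {v a : Fin p → Fin n} {w b : Fin q → Fin n} :
    patternOf (Fin.append v w) = patternOf (Fin.append a b) ↔
      patternOf v = patternOf a ∧ patternOf w = patternOf b ∧
        ∀ j i, w j = v i ↔ b j = a i := by
  simp only [patternOf_eq_iff]
  constructor
  · intro h
    refine ⟨fun i j => ?_, fun i j => ?_, fun j i => ?_⟩
    · simpa using h (Fin.castAdd q i) (Fin.castAdd q j)
    · simpa using h (Fin.natAdd p i) (Fin.natAdd p j)
    · simpa using h (Fin.natAdd p j) (Fin.castAdd q i)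
  · rintro ⟨h1, h2, h3⟩ i j
    induction i using Fin.addCases <;> induction j using Fin.addCases
    · simp [h1]
    · rename_i i j
      simp only [Fin.append_left, Fin.append_right]
      rw [eq_comm, h3 j i, eq_comm]
    · simp [h3]
    · simp [h2]

theorem exists_patternOf_append {n p q : ℕ} (γ : Pattern n (p + q)) :
    ∃ (a : Fin p → Fin n) (b : Fin q → Fin n), γ = patternOf (Fin.append a b) := by
  induction γ using Quotient.inductionOn with
  | h c => exact ⟨fun i => c (Fin.castAdd q i), fun j => c (Fin.natAdd p j),
      by rw [Fin.append_castAdd_natAdd]; rfl⟩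

/-- Tuples with the same equality pattern are related by a permutation. -/
theorem exists_perm_of_patternOf_eq {n q : ℕ} {a b : Fin q → Fin n}
    (h : patternOf a = patternOf b) : ∃ σ : Equiv.Perm (Fin n), σ ∘ a = b := by
  classical
  rw [patternOf_eq_iff] at h
  have hc : ∀ x : {x // x ∈ Set.range a}, a x.2.choose = x := fun x => x.2.choose_spec
  let e₀ : {x // x ∈ Set.range a} → {x // x ∈ Set.range b} := fun x => ⟨b x.2.choose, ⟨_, rfl⟩⟩
  have he : Function.Bijective e₀ := by
    constructor
    · intro x y hxy
      have h1 := (h x.2.choose y.2.choose).2 (congrArg Subtype.val hxy)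
      rw [hc, hc] at h1
      exact Subtype.ext h1
    · rintro ⟨_, i, rfl⟩
      exact ⟨⟨a i, i, rfl⟩, Subtype.ext ((h _ _).1 (hc ⟨a i, i, rfl⟩))⟩
  refine ⟨(Equiv.ofBijective e₀ he).extendSubtype, funext fun i => ?_⟩
  rw [Function.comp_apply, Equiv.extendSubtype_apply_of_mem _ _ ⟨i, rfl⟩]
  exact (h _ _).1 (hc ⟨a i, i, rfl⟩)

/-- The indicator function of `x = v i`, and the constant function `1`. -/
def anchorInd {n p : ℕ} (v : Fin p → Fin n) (o : Option (Fin p)) (x : Fin n) : ℝ :=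
  o.elim 1 fun i => if x = v i then 1 else 0

open Classical in
/-- The indicator function of prescribed equalities and inequalities with the entries of `v` is a
linear combination of anchors, with coefficients that only depend on the pattern of `v`. -/
theorem exists_anchorInd_expansion {n p : ℕ} (a : Fin p → Fin n) (y : Fin n) :
    ∃ C : Option (Fin p) → ℝ, ∀ v : Fin p → Fin n, patternOf v = patternOf a → ∀ x,
      (if ∀ i, x = v i ↔ y = a i then (1 : ℝ) else 0) = ∑ o, C o * anchorInd v o x := by
  by_cases hy : ∃ i₀, y = a i₀
  · obtain ⟨i₀, rfl⟩ := hy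
    refine ⟨Pi.single (some i₀) 1, fun v hv x => ?_⟩
    rw [patternOf_eq_iff] at hv
    rw [Finset.sum_eq_single (some i₀) (fun o _ ho => by simp [ho]) (by simp)]
    have : (∀ i, x = v i ↔ a i₀ = a i) ↔ x = v i₀ := by
      constructor
      · intro h; exact (h i₀).2 rfl
      · rintro rfl i; exact hv i₀ i
    simp [anchorInd, this]
  · push Not at hy
    -- Here `x` must avoid every entry of `v`: the indicator is `1` minus the sum of those of `x = v
    -- i`, each divided by the multiplicity of `v i` so that repeated entries count once.
    refine ⟨fun o => o.elim 1 fun i => -((Finset.univ.filter fun i' => a i' = a i).card : ℝ)⁻¹,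
      fun v hv x => ?_⟩
    rw [patternOf_eq_iff] at hv
    simp only [Fintype.sum_option, anchorInd, Option.elim, hy, iff_false, mul_one,
      ← hv]
    by_cases hx : ∃ i₀, x = v i₀
    · obtain ⟨i₀, rfl⟩ := hx
      have hne : ((Finset.univ.filter fun i' => v i' = v i₀).card : ℝ) ≠ 0 := by
        rw [Nat.cast_ne_zero]
        exact Finset.card_ne_zero.2 ⟨i₀, by simp⟩
      have hsum : ∑ i, -((Finset.univ.filter fun i' => v i' = v i).card : ℝ)⁻¹ *
          (if v i₀ = v i then 1 else 0) = -1 := by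
        simp only [mul_ite, mul_one, mul_zero]
        rw [← Finset.sum_filter]
        rw [Finset.sum_congr rfl (g := fun _ =>
          -((Finset.univ.filter fun i' => v i' = v i₀).card : ℝ)⁻¹)]
        · simp only [Finset.sum_const, nsmul_eq_mul, mul_neg]
          simp only [eq_comm (a := v i₀)]
          rw [mul_inv_cancel₀ hne]
        · intro i hi
          rw [(Finset.mem_filter.1 hi).2]
      rw [hsum, if_neg fun h => h i₀ rfl]
      norm_num
    · push Not at hx
      simp [hx]

/-- A pattern of `(v, w)` consists of the patterns of `v` and `w` and the equalities across. The
latter give a product over `j` of sums of anchors, which is multiplied out over the choices `e`. -/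
theorem exists_patInd_append_expansion {n p q : ℕ} (γ : Pattern n (p + q)) :
    ∃ (a : Fin p → Fin n) (b : Fin q → Fin n) (C : Fin q → Option (Fin p) → ℝ),
      (∀ v w, patternOf v ≠ patternOf a → patInd γ (Fin.append v w) = 0) ∧
      ∀ v w, patternOf v = patternOf a → patInd γ (Fin.append v w) =
        ∑ e : Fin q → Option (Fin p), (∏ j, C j (e j)) *
          (patInd (patternOf b) w * ∏ j, anchorInd v (e j) (w j)) := by
  classical
  obtain ⟨a, b, rfl⟩ := exists_patternOf_append γ
  choose C hC using fun j => exists_anchorInd_expansion a (b j)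
  refine ⟨a, b, C, fun v w hv => ?_, fun v w hv => ?_⟩
  · simp [patInd, patternOf_append_eq_iff, hv]
  · have h1 : patInd (patternOf (Fin.append a b)) (Fin.append v w) =
        patInd (patternOf b) w * ∏ j, if ∀ i, w j = v i ↔ b j = a i then (1 : ℝ) else 0 := by
      rw [Finset.prod_boole]
      simp only [patInd, patternOf_append_eq_iff, hv, true_and, Finset.mem_univ, true_imp_iff,
        ite_and, mul_ite, mul_one, mul_zero]
      split_ifs <;> rfl
    rw [h1]
    simp only [hC _ v hv]
    rw [Finset.prod_univ_sum, Fintype.piFinset_univ, Finset.mul_sum]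
    refine Finset.sum_congr rfl fun e _ => ?_
    rw [Finset.prod_mul_distrib]
    ring

/-- The default `i₀` only fills the free positions, whose entries the partial sum ignores. -/
theorem sum_anchorInd_eq_partialSum {n p q : ℕ} (f : (Fin q → Fin n) → ℝ) (v : Fin p → Fin n)
    (e : Fin q → Option (Fin p)) (i₀ : Fin p) :
    ∑ w, f w * ∏ j, anchorInd v (e j) (w j) =
      partialSum f (Finset.univ.filter fun j => e j = none) (v ∘ fun j => (e j).getD i₀) := by
  classical
  unfold partialSum
  rw [Finset.sum_filter]
  refine Finset.sum_congr rfl fun w _ => ?_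
  have : ∀ j, anchorInd v (e j) (w j) =
      if e j ≠ none → w j = v ((e j).getD i₀) then 1 else 0 := by
    intro j
    cases e j <;> simp [anchorInd]
  simp only [this, Finset.prod_boole]
  simp

/-! ### The cost of a layer in rounds. -/

theorem AtpEquiv.patternOf_eq {n ℓ q : ℕ} {G H : LGraph n ℓ} {w w' : Fin q → Fin n}
    (h : AtpEquiv G H w w') : patternOf w = patternOf w' :=
  patternOf_eq_iff.2 h.1

theorem WLInvariant.patInd_mul {n ℓ k r q : ℕ} {G H : LGraph n ℓ} {f f' : (Fin q → Fin n) → ℝ}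
    (hf : WLInvariant k r G H f f') (μ : Pattern n q) :
    WLInvariant k r G H (fun w => patInd μ w * f w) fun w => patInd μ w * f' w := by
  intro w w' hw
  simp only [hf w w' hw, patInd_congr hw.1.patternOf_eq]

/-- Sums over all tuples with a given pattern relative to a fixed tuple. -/
theorem sum_patInd_append_eq {n ℓ k r p q : ℕ} {G H : LGraph n ℓ} (hp : 0 < p)
    (hq : q + 1 ≤ k + 1) {f f' : (Fin (q + 1) → Fin n) → ℝ} (hf : WLInvariant k r G H f f')
    (hG : GlobalEquiv k r (q + 1) G H) {v v' : Fin p → Fin n}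
    (hv : WLEquiv k (r + q) G H v v') (γ : Pattern n (p + (q + 1))) :
    ∑ w, patInd γ (Fin.append v w) * f w = ∑ w, patInd γ (Fin.append v' w) * f' w := by
  classical
  obtain ⟨a, b, C, h0, h1⟩ := exists_patInd_append_expansion γ
  by_cases hva : patternOf v = patternOf a
  swap
  · have hva' : patternOf v' ≠ patternOf a := hv.1.patternOf_eq ▸ hva
    simp [h0 _ _ hva, h0 _ _ hva']
  have hva' : patternOf v' = patternOf a := hv.1.patternOf_eq ▸ hva
  have expand : ∀ (x : Fin p → Fin n) (g : (Fin (q + 1) → Fin n) → ℝ), patternOf x = patternOf a →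
      ∑ w, patInd γ (Fin.append x w) * g w = ∑ e : Fin (q + 1) → Option (Fin p),
        (∏ j, C j (e j)) * ∑ w, (patInd (patternOf b) w * g w) *
          ∏ j, anchorInd x (e j) (w j) := by
    intro x g hx
    simp only [h1 x _ hx, Finset.sum_mul, Finset.mul_sum]
    rw [Finset.sum_comm]
    refine Finset.sum_congr rfl fun e _ => Finset.sum_congr rfl fun w _ => ?_
    ring
  rw [expand v f hva, expand v' f' hva']
  refine Finset.sum_congr rfl fun e _ => congrArg _ ?_
  have hfb := hf.patInd_mul (patternOf b)
  rw [sum_anchorInd_eq_partialSum _ v e ⟨0, hp⟩, sum_anchorInd_eq_partialSum _ v' e ⟨0, hp⟩]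
  set N : Finset (Fin (q + 1)) := Finset.univ.filter fun j => e j = none
  -- With all positions free the sum no longer involves `v`, and `hG` applies; otherwise at most `q`
  -- positions are free, which `hv` pays for.
  by_cases hN : N = Finset.univ
  · rw [hN, partialSum_univ, partialSum_univ]
    exact hG _ _ hfb
  · refine partialSum_eq hq hfb N ((hv.mono ?_).comp _)
    have : N.card < q + 1 := by
      simpa using Finset.card_lt_univ_of_notMem
        (Classical.not_forall.1 (mt Finset.eq_univ_iff_forall.2 hN)).choose_spec
    omega

theorem EquivLayer.wlInvariant_apply {n ℓ k r m d d' : ℕ} {G H : LGraph n ℓ}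
    (L : EquivLayer n m d d') {F F' : (Fin m → Fin n) → Fin d → ℝ}
    (h : ∀ (γ : Pattern n (m + m)) (i : Fin d) (v v' : Fin m → Fin n), WLEquiv k r G H v v' →
      ∑ w, patInd γ (Fin.append v w) * F w i = ∑ w, patInd γ (Fin.append v' w) * F' w i) :
    WLInvariant k r G H (L.apply F) (L.apply F') := by
  intro v v' hv
  funext j
  have expand : ∀ (x : Fin m → Fin n) (E : (Fin m → Fin n) → Fin d → ℝ),
      (∑ γ : Pattern n (m + m), ∑ w : Fin m → Fin n,
        patInd γ (Fin.append x w) * ∑ i : Fin d, L.coeff γ i j * E w i) =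
      ∑ γ : Pattern n (m + m), ∑ i : Fin d, L.coeff γ i j *
        ∑ w, patInd γ (Fin.append x w) * E w i := by
    intro x E
    refine Finset.sum_congr rfl fun γ _ => ?_
    simp only [Finset.mul_sum]
    rw [Finset.sum_comm]
    refine Finset.sum_congr rfl fun i _ => Finset.sum_congr rfl fun w _ => ?_
    ring
  unfold EquivLayer.apply
  rw [expand, expand]
  simp only [h _ _ v v' hv, patInd_congr hv.1.patternOf_eq]

theorem EquivLayer.wlInvariant {n ℓ k r d d' : ℕ} {G H : LGraph n ℓ}
    (L : EquivLayer n (k + 1) d d') {F F' : (Fin (k + 1) → Fin n) → Fin d → ℝ}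
    (hF : WLInvariant k r G H F F') (hG : GlobalEquiv k r (k + 1) G H) :
    WLInvariant k (r + k) G H (L.apply F) (L.apply F') :=
  L.wlInvariant_apply fun γ i _ _ hv => sum_patInd_append_eq (Nat.succ_pos k) le_rfl
    (fun w w' hw => congrFun (hF w w' hw) i) hG hv γ

theorem InvLayer.apply_eq {n ℓ k r d d' : ℕ} {G H : LGraph n ℓ}
    (L : InvLayer n (k + 1) d d') {F F' : (Fin (k + 1) → Fin n) → Fin d → ℝ}
    (hF : WLInvariant k r G H F F') (hG : GlobalEquiv k r (k + 1) G H) :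
    L.apply F = L.apply F' := by
  funext j
  unfold InvLayer.apply
  congr 2
  refine Finset.sum_congr rfl fun μ _ => hG _ _ (WLInvariant.patInd_mul ?_ μ)
  intro w w' hw
  simp only [hF w w' hw]

/-! ### The first layer. -/

/-- Summing out all positions but those listed in `s` only costs a constant factor. -/
theorem exists_sum_patInd_append_comp {n p q s : ℕ} (γ : Pattern n (p + q))
    (g : Fin s → Fin q) :
    ∃ (δ : Pattern n (p + s)) (c : ℝ), ∀ (v : Fin p → Fin n) (A : (Fin s → Fin n) → ℝ),
      ∑ w, patInd γ (Fin.append v w) * A (w ∘ g) =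
        c * ∑ x, patInd δ (Fin.append v x) * A x := by
  classical
  obtain ⟨a, b, rfl⟩ := exists_patternOf_append γ
  let cnt : (Fin p → Fin n) → (Fin s → Fin n) → ℝ := fun v x =>
    ∑ w with w ∘ g = x, patInd (patternOf (Fin.append a b)) (Fin.append v w)
  have hcnt : ∀ v x, cnt v x =
      cnt a (b ∘ g) * patInd (patternOf (Fin.append a (b ∘ g))) (Fin.append v x) := by
    intro v x
    by_cases hvx : patternOf (Fin.append v x) = patternOf (Fin.append a (b ∘ g))
    · rw [patInd, if_pos hvx, mul_one]
      obtain ⟨σ, hσ⟩ := exists_perm_of_patternOf_eq hvx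
      have hσv : ∀ i, σ (v i) = a i := fun i => by
        simpa using congrFun hσ (Fin.castAdd s i)
      have hσx : ∀ i, σ (x i) = b (g i) := fun i => by
        simpa using congrFun hσ (Fin.natAdd p i)
      simp only [cnt, Finset.sum_filter]
      -- Relabelling the vertices by `σ` preserves patterns and carries the completions `w` of `x`
      -- to those of `b ∘ g`, so both are equally numerous.
      refine Fintype.sum_equiv (Equiv.arrowCongr (Equiv.refl _) σ) _ _ fun w => ?_
      have e1 : (w ∘ g = x) ↔ (Equiv.arrowCongr (Equiv.refl (Fin q)) σ w) ∘ g = b ∘ g := by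
        simp only [funext_iff, Function.comp_apply, ← hσx]
        simp
      have e2 : Fin.append a (Equiv.arrowCongr (Equiv.refl (Fin q)) σ w) =
          σ ∘ Fin.append v w := by
        funext i
        induction i using Fin.addCases <;> simp [hσv]
      have e3 : patternOf (σ ∘ Fin.append v w) = patternOf (Fin.append v w) :=
        patternOf_eq_iff.2 fun i j => by simp
      simp only [e1, patInd, e2, e3]
    · rw [patInd, if_neg hvx, mul_zero]
      refine Finset.sum_eq_zero fun w hw => if_neg fun h => hvx ?_
      obtain rfl := (Finset.mem_filter.1 hw).2
      rw [patternOf_append_eq_iff] at h ⊢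
      exact ⟨h.1, patternOf_comp h.2.1 g, fun j i => h.2.2 (g j) i⟩
  refine ⟨patternOf (Fin.append a (b ∘ g)), cnt a (b ∘ g), fun v A => ?_⟩
  rw [← Finset.sum_fiberwise _ (fun w : Fin q → Fin n => w ∘ g), Finset.mul_sum]
  refine Finset.sum_congr rfl fun x _ => ?_
  rw [← mul_assoc, ← hcnt, Finset.sum_mul]
  refine Finset.sum_congr rfl fun w hw => ?_
  rw [(Finset.mem_filter.1 hw).2]

/-- Every coordinate of an atomic type depends on two positions only. -/
theorem exists_atp_eq_comp {n ℓ m : ℕ} (G H : LGraph n ℓ) (x : AtpIdx m ℓ) :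
    ∃ (g : Fin 2 → Fin m) (A A' : (Fin 2 → Fin n) → ℝ),
      (∀ w w', AtpEquiv G H w w' → A w = A' w') ∧
      (∀ w, atp m G w x = A (w ∘ g)) ∧ ∀ w, atp m H w x = A' (w ∘ g) := by
  classical
  rcases x with p | p | ⟨i, s⟩
  · exact ⟨![p.1.1, p.1.2], fun w => if w 0 = w 1 then 1 else 0,
      fun w => if w 0 = w 1 then 1 else 0, fun w w' h => by simp only [h.1],
      fun w => by simp [atp], fun w => by simp [atp]⟩
  · exact ⟨![p.1.1, p.1.2], fun w => if G.graph.Adj (w 0) (w 1) then 1 else 0,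
      fun w => if H.graph.Adj (w 0) (w 1) then 1 else 0, fun w w' h => by simp only [h.2.1],
      fun w => by simp [atp], fun w => by simp [atp]⟩
  · exact ⟨fun _ => i, fun w => G.col (w 0) s, fun w => H.col (w 0) s,
      fun w w' h => by simp only [h.2.2], fun w => rfl, fun w => rfl⟩

theorem EquivLayer.wlInvariant_init {n ℓ k d' : ℕ} {G H : LGraph n ℓ} (hk : 1 ≤ k)
    (L : EquivLayer n (k + 1) (atpDim (k + 1) ℓ) d') (hG : GlobalEquiv k 0 2 G H) :
    WLInvariant k 1 G H (L.apply ((IGN.init : IGN n ℓ (k + 1) _ _).eval G))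
      (L.apply ((IGN.init : IGN n ℓ (k + 1) _ _).eval H)) := by
  refine L.wlInvariant_apply fun γ i v v' hv => ?_
  obtain ⟨g, A, A', hA, hAG, hAH⟩ :=
    exists_atp_eq_comp G H ((Fintype.equivFin (AtpIdx (k + 1) ℓ)).symm i)
  obtain ⟨δ, c, hc⟩ := exists_sum_patInd_append_comp γ g
  simp only [IGN.eval, hAG, hAH, hc]
  rw [sum_patInd_append_eq (k := k) (r := 0) (q := 1) (Nat.succ_pos k) (by omega)
    (fun w w' hw => hA w w' hw.1) hG (by simpa using hv) δ]

theorem IGN.wlInvariant_init {n ℓ k : ℕ} (G H : LGraph n ℓ) :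
    WLInvariant k 0 G H ((IGN.init : IGN n ℓ (k + 1) _ _).eval G)
      ((IGN.init : IGN n ℓ (k + 1) _ _).eval H) := by
  intro w w' hw
  simp only [IGN.eval, atp_eq_iff.2 hw.1]

/-! ### Whole networks and the count of rounds. -/

theorem IGN.wlInvariant_eval {n ℓ k t d : ℕ} {G H : LGraph n ℓ} (N : IGN n ℓ (k + 1) t d)
    (hG : ∀ s < t, GlobalEquiv k (s * k) (k + 1) G H) :
    WLInvariant k (t * k) G H (N.eval G) (N.eval H) := by
  induction N with
  | init => rw [Nat.zero_mul]; exact IGN.wlInvariant_init G H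
  | @layer t d d' N L ih =>
    rw [Nat.succ_mul]
    exact L.wlInvariant (ih fun s hs => hG s (hs.trans t.lt_succ_self)) (hG t t.lt_succ_self)

/-- The first layer is linear in the atomic types, which saves rounds. -/
theorem IGN.wlInvariant_eval_succ {n ℓ k t d : ℕ} {G H : LGraph n ℓ} (hk : 1 ≤ k)
    (N : IGN n ℓ (k + 1) (t + 1) d) (hG₀ : GlobalEquiv k 0 2 G H)
    (hG : ∀ s < t, GlobalEquiv k (s * k + 1) (k + 1) G H) :
    WLInvariant k (t * k + 1) G H (N.eval G) (N.eval H) := by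
  induction t generalizing d with
  | zero =>
    cases N with
    | layer N L =>
      cases N
      rw [Nat.zero_mul]
      exact L.wlInvariant_init hk hG₀
  | succ t ih =>
    cases N with
    | layer N L =>
      have h := L.wlInvariant (ih N fun s hs => hG s (hs.trans t.lt_succ_self))
        (hG t t.lt_succ_self)
      rwa [show (t + 1) * k + 1 = t * k + 1 + k by ring]

theorem vertexIGN_eq_of_vwl_eq {n ℓ k t : ℕ} (hk : 2 ≤ k) {p p' : LGraph n ℓ × Fin n}
    (h : vwl n ℓ k (t * k) p = vwl n ℓ k (t * k) p') (N : Σ d, IGN n ℓ (k + 1) t d) :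
    vertexIGN n ℓ (k + 1) t N p = vertexIGN n ℓ (k + 1) t N p' := by
  obtain ⟨d, N⟩ := N
  have hw : ∀ q, WLEquiv k (t * k) p.1 p'.1 (fun _ : Fin q => p.2) (fun _ : Fin q => p'.2) :=
    fun q => WLEquiv.const (by omega) h
  cases t with
  | zero => exact N.wlInvariant_eval (by simp) _ _ (hw _)
  | succ t =>
    have hglobal : ∀ r q, q ≤ k + 1 → r + q ≤ (t + 1) * k → GlobalEquiv k r q p.1 p'.1 :=
      fun r q hq hr => GlobalEquiv.of_wlEquiv hq ((hw q).mono hr)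
    -- The tightest bound is `(s * k + 1) + (k + 1) ≤ t * k + 2 ≤ (t + 1) * k` for `s < t`; its last
    -- step is where `2 ≤ k` is needed.
    refine N.wlInvariant_eval_succ (by omega) (hglobal _ _ (by omega) ?_) (fun s hs => ?_) _ _
      ((hw _).mono ?_)
    · rw [Nat.succ_mul]; omega
    · refine hglobal _ _ le_rfl ?_
      have := Nat.mul_le_mul_right k (Nat.succ_le_of_lt hs)
      rw [Nat.succ_mul] at this ⊢
      omega
    · rw [Nat.succ_mul]; omega

theorem vertexIGN_eq_of_vwl_one_eq {n ℓ t : ℕ} {p p' : LGraph n ℓ × Fin n}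
    (h : vwl n ℓ 1 (t * 2) p = vwl n ℓ 1 (t * 2) p') (N : Σ d, IGN n ℓ 2 t d) :
    vertexIGN n ℓ 2 t N p = vertexIGN n ℓ 2 t N p' := by
  have hw : ∀ q, WLEquiv 1 (t * 2) p.1 p'.1 (fun _ : Fin q => p.2) (fun _ : Fin q => p'.2) :=
    fun q => WLEquiv.const le_rfl h
  -- For `k = 1` the global sums need `s + 2 ≤ t * 2` rounds with `s < t`, so no saving in the first
  -- layer is required.
  exact N.2.wlInvariant_eval
    (fun s hs => GlobalEquiv.of_wlEquiv le_rfl ((hw _).mono (by omega))) _ _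
    ((hw _).mono (by omega))

theorem graphIGN_eq_of_gwl_eq {n ℓ k t : ℕ} (hk : 1 ≤ k) {G H : LGraph n ℓ}
    (h : gwl n ℓ k ((t + 1) * k) G = gwl n ℓ k ((t + 1) * k) H)
    (N : Σ d d', IGN n ℓ (k + 1) t d × InvLayer n (k + 1) d d') :
    graphIGN n ℓ (k + 1) t N G = graphIGN n ℓ (k + 1) t N H := by
  have hglobal : GlobalEquiv k (t * k) (k + 1) G H :=
    GlobalEquiv.of_gwl_eq (gwl_eq_mono (by rw [Nat.succ_mul]; omega) h)
  exact N.2.2.2.apply_eq (N.2.2.1.wlInvariant_eval fun s hs =>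
    hglobal.mono (Nat.mul_le_mul_right k hs.le)) hglobal

theorem vwl_eq_mono {n ℓ k r s : ℕ} (hrs : r ≤ s) {p p' : LGraph n ℓ × Fin n}
    (h : vwl n ℓ k s p = vwl n ℓ k s p') : vwl n ℓ k r p = vwl n ℓ k r p' :=
  wl_eq_mono hrs h

theorem theorem5 (k : ℕ) (hk : 1 ≤ k) (n ℓ t : ℕ) :
    -- vertex embeddings, `t` equivariant layers
    rhoOne (vwl n ℓ k (t * (k + 1))) ≤ rho (vertexIGN n ℓ (k + 1) t) ∧
    (2 ≤ k → rhoOne (vwl n ℓ k (t * k)) ≤ rho (vertexIGN n ℓ (k + 1) t)) ∧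
    -- graph embeddings, `t + 1` layers: `t` equivariant ones and the final invariant one
    rhoOne (gwl n ℓ k ((t + 1) * k)) ≤ rho (graphIGN n ℓ (k + 1) t) := by
  refine ⟨fun p p' h N => ?_, fun hk2 p p' h N => vertexIGN_eq_of_vwl_eq hk2 (h ()) N,
    fun G H h N => graphIGN_eq_of_gwl_eq hk (h ()) N⟩
  obtain rfl | hk2 := hk.eq_or_lt
  · exact vertexIGN_eq_of_vwl_one_eq (h ()) N
  · exact vertexIGN_eq_of_vwl_eq hk2
      (vwl_eq_mono (Nat.mul_le_mul_left t k.le_succ) (h ())) N
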